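/- Let $k\ge 0$ be an integer, and let $\mathcal P(k)$ be the (finite) set of noncrossing pairings of $\{1,\dots,k\}$, that is, of the partitions of $\{1,\dots,k\}$ all of whose blocks have exactly two elements and for which there are no $a<b<c<d$ with $a,c$ in one block and $b,d$ in another block. (So $\mathcal P(k)$ is empty for $k$ odd, and $\mathcal P(0)$ has one element.) For $n$ in a commutative ring let $$G_{kn}=\big(n^{|\pi\vee\sigma|}\big)_{\pi,\sigma\in\mathcal P(k)}$$ be the Gram matrix of $O_n^+$, where $\vee$ is the join in the lattice of all partitions of $\{1,\dots,k\}$ and $|\cdot|$ is the number of blocks; the determinant of the empty matrix is $1$. Let $P_r$ be the Chebyshev polynomials given by $P_0=1$, $P_1=n$, $P_{r+1}=nP_r-P_{r-1}$. For $s\in\frac12\mathbb Z$ and $r\in\mathbb Z$ put $$f_{sr}=\binom{2s}{s-r}-\binom{2s}{s-r-1}\ \text{ if } s\in\mathbb Z,\qquad f_{sr}=0\ \text{ if } s\notin\mathbb Z,\qquad d_{sr}=f_{sr}-f_{s,r+1},$$ where a binomial coefficient with negative lower entry is $0$. Theorem 5.1. For every $k\ge 0$, the identity $$\det(G_{kn})=\prod_{r=1}^{\lfloor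 k/2\rfloor}P_r(n)^{d_{k/2,r}}$$ holds in $\mathbb Q(n)$, the field of fractions of $\mathbb Z[n]$, with $n$ an indeterminate (some of the exponents $d_{k/2,r}$ can be negative). Consequently it also holds for every element $n$ of every field such that $P_r(n)\neq 0$ for all $1\le r\le \lfloor k/2\rfloor$ with $d_{k/2,r}<0$ (with the convention $0^0=1$). -/

import Mathlib

open Polynomial

noncomputable section

/-- The noncrossing pairings of the `k` points `0 < 1 < ⋯ < k - 1`. A partition of the points is
an equivalence relation, whose classes are the blocks. -/
def NCPairing (k : ℕ) : Type :=
  {π : Setoid (Fin k) //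
    (∀ a, {b | π a b}.ncard = 2) ∧
    (∀ a b c d, a < b → b < c → c < d → π a c → π b d → π a b)}

instance (k : ℕ) : Finite (NCPairing k) := by
  have h : Function.Injective
      (fun (π : NCPairing k) (a b : Fin k) => (π.1 a b : Prop)) := by
    intro π σ hπσ
    apply Subtype.ext
    ext a b
    exact iff_of_eq (congrFun (congrFun hπσ a) b)
  exact Finite.of_injective _ h

instance (k : ℕ) : Fintype (NCPairing k) := Fintype.ofFinite _

instance (k : ℕ) : DecidableEq (NCPairing k) := Classical.decEq _

/-- The number of blocks of a partition of `k` points. -/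
def blockCount {k : ℕ} (π : Setoid (Fin k)) : ℕ := Nat.card (Quotient π)

/-- The Gram matrix of the noncrossing pairings of `k` points, with parameter `n`. The join is
taken in the lattice of all partitions. -/
def gramMatrix {R : Type*} [CommRing R] (k : ℕ) (n : R) :
    Matrix (NCPairing k) (NCPairing k) R :=
  Matrix.of fun π σ => n ^ blockCount (π.1 ⊔ σ.1)

/-- The binomial coefficient of two integers, zero when the lower one is negative. -/
def intChoose (m j : ℤ) : ℤ := if 0 ≤ j then Ring.choose m j.toNat else 0

/-- The numbers `f_{s,r}`, equal to zero when `s` is not an integer. -/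
def fNumber (s : ℚ) (r : ℤ) : ℤ :=
  if s.den = 1 then
    intChoose (2 * s.num) (s.num - r) - intChoose (2 * s.num) (s.num - r - 1)
  else 0

/-- The exponents `d_{s,r}`. -/
def dNumber (s : ℚ) (r : ℤ) : ℤ := fNumber s r - fNumber s (r + 1)

end

namespace Meander

/-- The lists of steps (`true` is up, `false` is down) of the walks of length `k` on the
nonnegative integers that start at `a` and end at `0`. -/
def paths : ℕ → ℕ → Finset (List Bool)
  | 0, 0 => {[]}
  | 0, _ + 1 => ∅
  | k + 1, 0 => (paths k 1).map ⟨List.cons true, List.cons_injective⟩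
  | k + 1, a + 1 =>
    ((paths k (a + 2)).map ⟨List.cons true, List.cons_injective⟩).disjUnion
      ((paths k a).map ⟨List.cons false, List.cons_injective⟩)
      (by
        rw [Finset.disjoint_left]
        intro p hp hq
        simp only [Finset.mem_map, Function.Embedding.coeFn_mk] at hp hq
        obtain ⟨x, -, rfl⟩ := hp
        obtain ⟨y, -, hy⟩ := hq
        simp at hy)

@[simp] lemma true_cons_mem_paths {k a : ℕ} {p : List Bool} :
    true :: p ∈ paths (k + 1) a ↔ p ∈ paths k (a + 1) := by
  cases a <;> simp [paths]

@[simp] lemma false_cons_mem_paths {k a : ℕ} {p : List Bool} :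
    false :: p ∈ paths (k + 1) (a + 1) ↔ p ∈ paths k a := by
  simp [paths]

@[simp] lemma false_cons_notMem_paths {k : ℕ} {p : List Bool} :
    false :: p ∉ paths (k + 1) 0 := by
  simp [paths]

lemma length_of_mem_paths {k a : ℕ} {p : List Bool} (h : p ∈ paths k a) : p.length = k := by
  induction k generalizing a p with
  | zero => cases a <;> simp_all [paths]
  | succ k ih =>
    cases a <;> simp only [paths, Finset.mem_disjUnion, Finset.mem_map,
      Function.Embedding.coeFn_mk] at h
    · obtain ⟨q, hq, rfl⟩ := h
      simp [ih hq]
    · obtain ⟨q, hq, rfl⟩ | ⟨q, hq, rfl⟩ := h <;> simp [ih hq]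

/-- The walk does not become negative when it starts at `a`. -/
def StaysNonneg : ℕ → List Bool → Prop
  | _, [] => True
  | a, true :: p => StaysNonneg (a + 1) p
  | 0, false :: _ => False
  | a + 1, false :: p => StaysNonneg a p

lemma staysNonneg_of_mem_paths {k a : ℕ} {p : List Bool} (h : p ∈ paths k a) :
    StaysNonneg a p := by
  induction k generalizing a p with
  | zero => cases a <;> simp_all [paths, StaysNonneg]
  | succ k ih =>
    rcases a with _ | a <;> simp only [paths, Finset.mem_disjUnion, Finset.mem_map,
      Function.Embedding.coeFn_mk] at h
    · obtain ⟨q, hq, rfl⟩ := h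
      exact ih (a := 1) hq
    · obtain ⟨q, hq, rfl⟩ | ⟨q, hq, rfl⟩ := h
      · exact ih (a := a + 2) hq
      · exact ih (a := a) hq

@[to_additive]
lemma prod_paths_zero {M : Type*} [CommMonoid M] (k : ℕ) (g : List Bool → M) :
    ∏ p ∈ paths (k + 1) 0, g p = ∏ p ∈ paths k 1, g (true :: p) := by
  simp [paths]

@[to_additive]
lemma prod_paths_succ {M : Type*} [CommMonoid M] (k a : ℕ) (g : List Bool → M) :
    ∏ p ∈ paths (k + 1) (a + 1), g p =
      (∏ p ∈ paths k (a + 2), g (true :: p)) * ∏ p ∈ paths k a, g (false :: p) := by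
  rw [paths, Finset.prod_disjUnion]
  simp

section

variable {F : Type*} [Field F]

/-- The weight of a walk from `a`: each step up from `b` contributes `P (b + 1) / P b`. -/
def weight (P : ℕ → F) : ℕ → List Bool → F
  | _, [] => 1
  | a, true :: p => P (a + 1) / P a * weight P (a + 1) p
  | 0, false :: _ => 1
  | a + 1, false :: p => weight P a p

/-- The operator on functions of walks from height `a` that inserts two opposite steps after the
first `i` steps. -/
def cup (P : ℕ → F) : ℕ → ℕ → (List Bool → F) → List Bool → F
  | 0, _, u, true :: false :: p => u p
  | 0, a + 1, u, false :: true :: p => P a / P (a + 1) * u p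
  | i + 1, a, u, true :: p => cup P i (a + 1) (fun q => u (true :: q)) p
  | i + 1, a + 1, u, false :: p => cup P i a (fun q => u (false :: q)) p
  | _, _, _, _ => 0

/-- The adjoint of `cup`, see `sum_weight_mul_cup`. -/
def cap (P : ℕ → F) : ℕ → ℕ → (List Bool → F) → List Bool → F
  | 0, 0, u, p => P 1 / P 0 * u (true :: false :: p)
  | 0, a + 1, u, p =>
    P (a + 2) / P (a + 1) * u (true :: false :: p) + u (false :: true :: p)
  | i + 1, a, u, true :: p => cap P i (a + 1) (fun q => u (true :: q)) p
  | i + 1, a + 1, u, false :: p => cap P i a (fun q => u (false :: q)) p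
  | _ + 1, _, _, _ => 0

variable {P : ℕ → F} {n : F}

lemma cup_zero_right (i a : ℕ) (p : List Bool) : cup P i a (fun _ => 0) p = 0 := by
  induction i generalizing a p with
  | zero =>
    rcases a with _ | a <;> rcases p with _ | ⟨_ | _, _ | ⟨_ | _, p⟩⟩ <;> simp [cup]
  | succ i ih => rcases a with _ | a <;> rcases p with _ | ⟨_ | _, p⟩ <;> simp [cup, ih]

lemma cup_linear (i a : ℕ) (x y : F) (u v : List Bool → F) (p : List Bool) :
    cup P i a (fun q => x * u q + y * v q) p = x * cup P i a u p + y * cup P i a v p := by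
  induction i generalizing a p u v with
  | zero =>
    rcases a with _ | a <;> rcases p with _ | ⟨_ | _, _ | ⟨_ | _, p⟩⟩ <;> simp [cup]
    ring
  | succ i ih =>
    rcases a with _ | a <;> rcases p with _ | ⟨_ | _, p⟩ <;> simp only [cup, ih] <;> simp

lemma cup_const_mul (i a : ℕ) (x : F) (u : List Bool → F) (p : List Bool) :
    cup P i a (fun q => x * u q) p = x * cup P i a u p := by
  simpa using cup_linear (P := P) i a x 0 u u p

lemma cap_const_mul (i a : ℕ) (x : F) (u : List Bool → F) (p : List Bool) :
    cap P i a (fun q => x * u q) p = x * cap P i a u p := by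
  induction i generalizing a p u with
  | zero => rcases a with _ | a <;> simp only [cap] <;> ring
  | succ i ih => rcases a with _ | a <;> rcases p with _ | ⟨_ | _, p⟩ <;> simp [cap, ih]

lemma cap_zero_right (i a : ℕ) (p : List Bool) : cap P i a (fun _ => 0) p = 0 := by
  simpa using cap_const_mul (P := P) i a 0 (fun _ => 0) p

lemma cup_congr {i a : ℕ} {u v : List Bool → F} {p : List Bool}
    (h : ∀ q, StaysNonneg a q → q.length + 2 = p.length → u q = v q)
    (hp : StaysNonneg a p) : cup P i a u p = cup P i a v p := by
  induction i generalizing a p u v with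
  | zero =>
    rcases a with _ | a <;> rcases p with _ | ⟨_ | _, _ | ⟨_ | _, p⟩⟩ <;>
      simp_all [cup, StaysNonneg]
  | succ i ih =>
    rcases a with _ | a <;> rcases p with _ | ⟨_ | _, p⟩ <;> simp only [cup]
    · exact ih (a := 1) (fun q hq hl => h (true :: q) hq (by simp [← hl])) hp
    · exact ih (a := a) (fun q hq hl => h (false :: q) hq (by simp [← hl])) hp
    · exact ih (a := a + 2) (fun q hq hl => h (true :: q) hq (by simp [← hl])) hp

lemma sum_weight_mul_cup (hP : ∀ a, P a ≠ 0) {i k : ℕ} (hi : i ≤ k) (a : ℕ)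
    (u v : List Bool → F) :
    ∑ p ∈ paths (k + 2) a, weight P a p * cup P i a u p * v p =
      ∑ p ∈ paths k a, weight P a p * u p * cap P i a v p := by
  induction i generalizing k a u v with
  | zero =>
    rcases a with _ | _ | a <;>
      simp only [sum_paths_zero, sum_paths_succ, cup, cap, weight, mul_zero, zero_mul,
        Finset.sum_const_zero, add_zero, zero_add, ← Finset.sum_add_distrib]
    all_goals
      refine Finset.sum_congr rfl fun p _ => ?_
      have h0 := hP 0
      have h1 := hP 1
      have h2 := hP 2
      have h3 := fun b => hP (b + 1)
      have h4 := fun b => hP (b + 2)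
      have h5 := fun b => hP (b + 3)
      field_simp [h3, h4, h5]
  | succ i ih =>
    obtain ⟨k, rfl⟩ : ∃ l, k = l + 1 := ⟨k - 1, by omega⟩
    rcases a with _ | a
    · simp only [sum_paths_zero, cup, cap, weight, mul_assoc, ← Finset.mul_sum]
      have := ih (k := k) (by omega) 1 (fun q => u (true :: q)) (fun q => v (true :: q))
      simp only [mul_assoc] at this
      rw [this]
    · rw [sum_paths_succ k, show k + 1 + 2 = k + 2 + 1 from rfl, sum_paths_succ (k + 2)]
      simp only [cup, cap, weight, mul_assoc, ← Finset.mul_sum]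
      have h1 := ih (k := k) (by omega) (a + 2) (fun q => u (true :: q)) (fun q => v (true :: q))
      have h2 := ih (k := k) (by omega) a (fun q => u (false :: q)) (fun q => v (false :: q))
      simp only [mul_assoc] at h1 h2
      exact congrArg₂ _ (congrArg _ h1) h2

lemma cap_cup_self (hP : ∀ a, P a ≠ 0) (h0 : P 1 = n * P 0)
    (hrec : ∀ a, P (a + 2) = n * P (a + 1) - P a) (i : ℕ) {a : ℕ} (u : List Bool → F)
    {p : List Bool} (hp : StaysNonneg a p) (hi : i ≤ p.length) :
    cap P i a (cup P i a u) p = n * u p := by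
  induction i generalizing a p u with
  | zero =>
    rcases a with _ | a
    · have := hP 0
      simp only [cap, cup, h0]
      field_simp
    · have := hP (a + 1)
      simp only [cap, cup, hrec]
      field_simp
      ring
  | succ i ih =>
    rcases a with _ | a <;> rcases p with _ | ⟨_ | _, p⟩ <;> simp only [cup, cap]
    all_goals first
      | exact ih _ hp (by simpa using hi)
      | simp [StaysNonneg] at hp hi

lemma cap_cup_succ (hP : ∀ a, P a ≠ 0) (i : ℕ) {a : ℕ} (u : List Bool → F)
    {p : List Bool} (hp : StaysNonneg a p) (hi : i + 1 ≤ p.length) :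
    cap P i a (cup P (i + 1) a u) p = u p := by
  induction i generalizing a p u with
  | zero =>
    rcases a with _ | a <;> rcases p with _ | ⟨_ | _, p⟩ <;>
      simp_all [cup, cap, StaysNonneg]
    · have := hP 0
      have := hP 1
      field_simp
    · have := hP (a + 1)
      have := hP (a + 2)
      field_simp
  | succ i ih =>
    rcases a with _ | a <;> rcases p with _ | ⟨_ | _, p⟩
    all_goals first
      | exact ih _ hp (by simpa using hi)
      | simp [StaysNonneg] at hp hi

lemma cap_succ_cup (hP : ∀ a, P a ≠ 0) (i : ℕ) {a : ℕ} (u : List Bool → F)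
    {p : List Bool} (hp : StaysNonneg a p) (hi : i + 1 ≤ p.length) :
    cap P (i + 1) a (cup P i a u) p = u p := by
  induction i generalizing a p u with
  | zero =>
    rcases a with _ | _ | a <;> rcases p with _ | ⟨_ | _, p⟩ <;>
      simp_all [cup, cap, StaysNonneg]
    · have := hP 0
      have := hP 1
      field_simp
    · have := hP (a + 1)
      have := hP (a + 2)
      field_simp
  | succ i ih =>
    rcases a with _ | a <;> rcases p with _ | ⟨_ | _, p⟩
    all_goals first
      | exact ih _ hp (by simpa using hi)
      | simp [StaysNonneg] at hp hi

lemma cap_cup_of_le {i j : ℕ} (hij : i ≤ j) {a : ℕ} (u : List Bool → F)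
    {p : List Bool} (hp : StaysNonneg a p) (hj : j ≤ p.length) :
    cap P i a (cup P (j + 2) a u) p = cup P j a (cap P i a u) p := by
  induction i generalizing a p u j with
  | zero =>
    rcases a with _ | a <;> simp only [cap, cup]
    · exact (cup_const_mul _ _ _ _ _).symm
    · have := cup_linear (P := P) j (a + 1) (P (a + 2) / P (a + 1)) 1
        (fun q => u (true :: false :: q)) (fun q => u (false :: true :: q)) p
      simp only [one_mul] at this
      exact this.symm
  | succ i ih =>
    obtain ⟨j, rfl⟩ : ∃ l, j = l + 1 := ⟨j - 1, by omega⟩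
    rcases a with _ | a <;> rcases p with _ | ⟨_ | _, p⟩
    all_goals first
      | exact ih (by omega) _ hp (by simpa using hj)
      | simp [StaysNonneg] at hp hj

lemma cap_add_two_cup {i j : ℕ} (hij : j ≤ i) {a : ℕ} (u : List Bool → F)
    {p : List Bool} (hp : StaysNonneg a p) (hi : i + 2 ≤ p.length) :
    cap P (i + 2) a (cup P j a u) p = cup P j a (cap P i a u) p := by
  induction j generalizing a p u i with
  | zero =>
    rcases a with _ | _ | a <;> rcases p with _ | ⟨_ | _, _ | ⟨_ | _, p⟩⟩ <;>
      simp_all [cap, cup, StaysNonneg, cap_const_mul, cap_zero_right]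
  | succ j ih =>
    obtain ⟨i, rfl⟩ : ∃ l, i = l + 1 := ⟨i - 1, by omega⟩
    rcases a with _ | a <;> rcases p with _ | ⟨_ | _, p⟩
    all_goals first
      | exact ih (by omega) _ hp (by simpa using hi)
      | simp [StaysNonneg] at hp hi

end

/-- The increasing map of the natural numbers that avoids `i` and `i + 1`. -/
def skip (i j : ℕ) : ℕ := if j < i then j else j + 2

lemma skip_of_lt {i j : ℕ} (h : j < i) : skip i j = j := if_pos h

lemma skip_of_le {i j : ℕ} (h : i ≤ j) : skip i j = j + 2 := if_neg (by omega)

lemma skip_ne (i j : ℕ) : skip i j ≠ i := by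
  unfold skip; split_ifs <;> omega

lemma skip_ne_succ (i j : ℕ) : skip i j ≠ i + 1 := by
  unfold skip; split_ifs <;> omega

lemma skip_strictMono (i : ℕ) : StrictMono (skip i) := by
  intro a b h
  unfold skip; split_ifs <;> omega

lemma skip_injective (i : ℕ) : Function.Injective (skip i) := (skip_strictMono i).injective

lemma skip_cases (i x : ℕ) : x = i ∨ x = i + 1 ∨ ∃ y, x = skip i y := by
  rcases lt_trichotomy x i with h | h | h
  · exact .inr (.inr ⟨x, (skip_of_lt h).symm⟩)
  · exact .inl h
  · by_cases hx : x = i + 1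
    · exact .inr (.inl hx)
    · exact .inr (.inr ⟨x - 2, by rw [skip_of_le] <;> omega⟩)

lemma skip_lt {i j k : ℕ} (hi : i ≤ k) : skip i j < k + 2 ↔ j < k := by
  unfold skip; split_ifs <;> omega

lemma skip_skip {i j : ℕ} (h : i ≤ j) (x : ℕ) : skip i (skip j x) = skip (j + 2) (skip i x) := by
  unfold skip; split_ifs <;> omega

/-- The finest partition in which `x` and `y` are equivalent. -/
def pair (x y : ℕ) : Setoid ℕ where
  r u v := u = v ∨ (u = x ∧ v = y) ∨ (u = y ∧ v = x)
  iseqv := ⟨fun _ => .inl rfl, by tauto, by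
    intro a b c h h'
    omega⟩

lemma pair_le_iff {x y : ℕ} {τ : Setoid ℕ} : pair x y ≤ τ ↔ τ x y := by
  refine ⟨fun h => h (.inr (.inl ⟨rfl, rfl⟩)), ?_⟩
  rintro h u v (rfl | ⟨rfl, rfl⟩ | ⟨rfl, rfl⟩)
  exacts [τ.refl _, h, τ.symm h]

/-- The partition obtained by inserting the block `{i, i + 1}`. -/
def insertPair (i : ℕ) (σ : Setoid ℕ) : Setoid ℕ where
  r u v := u = v ∨ (u = i ∧ v = i + 1) ∨ (u = i + 1 ∧ v = i) ∨
    ∃ a b, u = skip i a ∧ v = skip i b ∧ σ a b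
  iseqv := by
    refine ⟨fun _ => .inl rfl, ?_, ?_⟩
    · rintro u v (h | h | h | ⟨a, b, hu, hv, h⟩)
      · exact .inl h.symm
      · tauto
      · tauto
      · exact .inr (.inr (.inr ⟨b, a, hv, hu, σ.symm h⟩))
    · rintro u v w (rfl | ⟨rfl, rfl⟩ | ⟨rfl, rfl⟩ | ⟨a, b, rfl, rfl, h⟩) h'
      · exact h'
      · rcases h' with rfl | h' | h' | ⟨c, d, hc, -⟩
        · tauto
        · omega
        · tauto
        · exact absurd hc.symm (skip_ne_succ _ _)
      · rcases h' with rfl | h' | h' | ⟨c, d, hc, -⟩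
        · tauto
        · tauto
        · omega
        · exact absurd hc.symm (skip_ne _ _)
      · rcases h' with rfl | h' | h' | ⟨c, d, hc, rfl, h'⟩
        · exact .inr (.inr (.inr ⟨a, b, rfl, rfl, h⟩))
        · exact absurd h'.1 (skip_ne _ _)
        · exact absurd h'.1 (skip_ne_succ _ _)
        · obtain rfl := skip_injective _ hc
          exact .inr (.inr (.inr ⟨a, d, rfl, rfl, σ.trans h h'⟩))

section

variable {σ τ π : Setoid ℕ} {i j x y : ℕ}

@[simp] lemma insertPair_skip_skip : insertPair i σ (skip i x) (skip i y) ↔ σ x y := by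
  constructor
  · rintro (h | ⟨h, -⟩ | ⟨h, -⟩ | ⟨a, b, ha, hb, h⟩)
    · rw [skip_injective _ h]
    · exact absurd h (skip_ne _ _)
    · exact absurd h (skip_ne_succ _ _)
    · rwa [skip_injective _ ha, skip_injective _ hb]
  · exact fun h => .inr (.inr (.inr ⟨x, y, rfl, rfl, h⟩))

lemma insertPair_self_succ : insertPair i σ i (i + 1) := .inr (.inl ⟨rfl, rfl⟩)

lemma not_insertPair_skip : ¬ insertPair i σ i (skip i x) := by
  rintro (h | ⟨-, h⟩ | ⟨h, -⟩ | ⟨a, b, ha, -⟩)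
  · exact skip_ne _ _ h.symm
  · exact skip_ne_succ _ _ h
  · omega
  · exact skip_ne _ _ ha.symm

lemma insertPair_le_iff :
    insertPair i σ ≤ τ ↔ σ ≤ τ.comap (skip i) ∧ τ i (i + 1) := by
  refine ⟨fun h => ⟨fun a b hab => h (insertPair_skip_skip.2 hab), h insertPair_self_succ⟩, ?_⟩
  rintro ⟨h1, h2⟩ u v (rfl | ⟨rfl, rfl⟩ | ⟨rfl, rfl⟩ | ⟨a, b, rfl, rfl, h⟩)
  exacts [τ.refl _, h2, τ.symm h2, h1 h]

lemma eq_insertPair (h : τ i (i + 1)) (h' : ∀ x, ¬ τ i (skip i x)) :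
    τ = insertPair i (τ.comap (skip i)) := by
  refine le_antisymm ?_ (insertPair_le_iff.2 ⟨le_rfl, h⟩)
  intro u v huv
  have h1 : ∀ x, ¬ τ (i + 1) (skip i x) := fun x hx => h' x (τ.trans h hx)
  obtain hu | hu | ⟨a, rfl⟩ := skip_cases i u <;> obtain hv | hv | ⟨b, rfl⟩ := skip_cases i v <;>
    subst_vars
  · exact .inl rfl
  · exact insertPair_self_succ
  · exact absurd huv (h' _)
  · exact .inr (.inr (.inl ⟨rfl, rfl⟩))
  · exact .inl rfl
  · exact absurd huv (h1 _)
  · exact absurd (τ.symm huv) (h' _)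
  · exact absurd (τ.symm huv) (h1 _)
  · exact insertPair_skip_skip.2 huv

@[simp] lemma comap_insertPair : (insertPair i σ).comap (skip i) = σ := by
  ext x y
  exact insertPair_skip_skip

lemma insertPair_sup : insertPair i (σ ⊔ τ) = insertPair i σ ⊔ insertPair i τ := by
  refine eq_of_forall_ge_iff fun ρ => ?_
  simp only [insertPair_le_iff, sup_le_iff]
  tauto

lemma insertPair_sup_pair :
    insertPair i (σ ⊔ pair x y) = insertPair i σ ⊔ pair (skip i x) (skip i y) := by
  refine eq_of_forall_ge_iff fun ρ => ?_
  simp only [insertPair_le_iff, sup_le_iff, pair_le_iff, Setoid.comap_rel]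
  tauto

/-- The partition obtained by joining `i` and `i + 1` and then forgetting both points. -/
def contract (i : ℕ) (σ : Setoid ℕ) : Setoid ℕ := (σ ⊔ pair i (i + 1)).comap (skip i)

lemma contract_insertPair_self : contract i (insertPair i σ) = σ := by
  rw [contract, sup_eq_left.2 (pair_le_iff.2 insertPair_self_succ), comap_insertPair]

lemma comap_skip_insertPair_sup :
    (insertPair i π ⊔ σ).comap (skip i) = π ⊔ contract i σ := by
  apply le_antisymm
  · set ρ := σ ⊔ pair i (i + 1) with hρ
    set τ := π ⊔ contract i σ with hτ
    have hle : ∀ {a b}, ρ (skip i a) (skip i b) → τ a b := fun {a b} h =>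
      (le_sup_right : contract i σ ≤ τ) h
    let E : Setoid ℕ :=
      { r := fun u v => ρ u v ∨ ∃ a b, ρ u (skip i a) ∧ τ a b ∧ ρ (skip i b) v
        iseqv := by
          refine ⟨fun _ => .inl (ρ.refl _), ?_, ?_⟩
          · rintro u v (h | ⟨a, b, h1, h2, h3⟩)
            · exact .inl (ρ.symm h)
            · exact .inr ⟨b, a, ρ.symm h3, τ.symm h2, ρ.symm h1⟩
          · rintro u v w (h | ⟨a, b, h1, h2, h3⟩) (h' | ⟨c, d, h1', h2', h3'⟩)
            · exact .inl (ρ.trans h h')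
            · exact .inr ⟨c, d, ρ.trans h h1', h2', h3'⟩
            · exact .inr ⟨a, b, h1, h2, ρ.trans h3 h'⟩
            · exact .inr ⟨a, d, h1, τ.trans h2 (τ.trans (hle (ρ.trans h3 h1')) h2'), h3'⟩ }
    have hE : insertPair i π ⊔ σ ≤ E := by
      refine sup_le (insertPair_le_iff.2 ⟨fun a b h => ?_, ?_⟩) fun a b h => ?_
      · exact .inr ⟨a, b, ρ.refl _, (le_sup_left : π ≤ τ) h, ρ.refl _⟩
      · exact .inl (pair_le_iff.1 le_sup_right)
      · exact .inl ((le_sup_left : σ ≤ ρ) h)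
    intro a b h
    rcases hE h with h | ⟨c, d, h1, h2, h3⟩
    · exact hle h
    · exact τ.trans (hle h1) (τ.trans h2 (hle h3))
  · refine sup_le (fun a b h => ?_) fun a b h => ?_
    · exact (le_sup_left : insertPair i π ≤ insertPair i π ⊔ σ) (insertPair_skip_skip.2 h)
    · refine (sup_le le_sup_right (pair_le_iff.2 ?_) : σ ⊔ pair i (i + 1) ≤ insertPair i π ⊔ σ) h
      exact (le_sup_left : insertPair i π ≤ insertPair i π ⊔ σ) insertPair_self_succ

lemma sup_pair_le_comap :
    insertPair (i + 1) σ ⊔ pair i (i + 1) ≤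
        σ.comap (fun j => if j ≤ i then j else if j = i + 1 then i else j - 2) ∧
      insertPair i σ ⊔ pair (i + 1) (i + 2) ≤
        σ.comap (fun j => if j ≤ i then j else if j = i + 1 then i else j - 2) := by
  simp only [sup_le_iff, insertPair_le_iff, pair_le_iff, Setoid.comap_rel]
  refine ⟨⟨⟨fun a b h => ?_, ?_⟩, ?_⟩, ⟨⟨fun a b h => ?_, ?_⟩, ?_⟩⟩
  all_goals try simp only [Setoid.comap_rel, skip]
  · convert h using 1 <;> split_ifs <;> omega
  · convert σ.refl i using 1 <;> split_ifs <;> omega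
  · convert σ.refl i using 1 <;> split_ifs <;> omega
  · convert h using 1 <;> split_ifs <;> omega
  · convert σ.refl i using 1 <;> split_ifs <;> omega
  · convert σ.refl i using 1 <;> split_ifs <;> omega

lemma contract_insertPair_succ : contract i (insertPair (i + 1) σ) = σ := by
  apply le_antisymm
  · intro a b h
    have := sup_pair_le_comap.1 h
    simp only [Setoid.comap_rel, skip] at this
    convert this using 1 <;> split_ifs <;> omega
  · intro a b h
    set ρ := insertPair (i + 1) σ ⊔ pair i (i + 1) with hρ
    have key : ∀ c, ρ (skip i c) (skip (i + 1) c) := by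
      intro c
      by_cases hc : c = i
      · subst hc
        rw [skip_of_le le_rfl, skip_of_lt (by omega)]
        have h1 : ρ c (c + 1) := pair_le_iff.1 le_sup_right
        have h2 : ρ (c + 1) (c + 2) :=
          (le_sup_left : insertPair (c + 1) σ ≤ ρ) insertPair_self_succ
        exact ρ.symm (ρ.trans h1 h2)
      · convert ρ.refl _ using 1
        unfold skip; split_ifs <;> omega
    have h3 : ρ (skip (i + 1) a) (skip (i + 1) b) :=
      (le_sup_left : insertPair (i + 1) σ ≤ ρ) (insertPair_skip_skip.2 h)
    exact ρ.trans (key a) (ρ.trans h3 (ρ.symm (key b)))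

lemma contract_succ_insertPair : contract (i + 1) (insertPair i σ) = σ := by
  apply le_antisymm
  · intro a b h
    have := sup_pair_le_comap.2 h
    simp only [Setoid.comap_rel, skip] at this
    convert this using 1 <;> split_ifs <;> omega
  · intro a b h
    set ρ := insertPair i σ ⊔ pair (i + 1) (i + 1 + 1) with hρ
    have key : ∀ c, ρ (skip (i + 1) c) (skip i c) := by
      intro c
      by_cases hc : c = i
      · subst hc
        rw [skip_of_le le_rfl, skip_of_lt (by omega)]
        have h1 : ρ (c + 1) (c + 2) := pair_le_iff.1 le_sup_right
        have h2 : ρ c (c + 1) :=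
          (le_sup_left : insertPair c σ ≤ ρ) insertPair_self_succ
        exact ρ.trans h2 h1
      · convert ρ.refl _ using 1
        unfold skip; split_ifs <;> omega
    have h3 : ρ (skip i a) (skip i b) :=
      (le_sup_left : insertPair i σ ≤ ρ) (insertPair_skip_skip.2 h)
    exact ρ.trans (key a) (ρ.trans h3 (ρ.symm (key b)))

lemma comap_skip_insertPair_add_two (h : i ≤ j) :
    (insertPair (j + 2) τ).comap (skip i) = insertPair j (τ.comap (skip i)) := by
  have h1 := eq_insertPair (i := j) (τ := (insertPair (j + 2) τ).comap (skip i)) ?_ ?_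
  · rw [h1]
    congr 1
    ext x y
    simp only [Setoid.comap_rel, skip_skip h, insertPair_skip_skip]
  · rw [Setoid.comap_rel, skip_of_le h, skip_of_le (by omega)]
    exact insertPair_self_succ
  · intro x
    rw [Setoid.comap_rel, skip_skip h, skip_of_le h]
    exact not_insertPair_skip

lemma comap_skip_add_two_insertPair (h : j ≤ i) :
    (insertPair j τ).comap (skip (i + 2)) = insertPair j (τ.comap (skip i)) := by
  have h1 := eq_insertPair (i := j) (τ := (insertPair j τ).comap (skip (i + 2))) ?_ ?_
  · rw [h1]
    congr 1
    ext x y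
    simp only [Setoid.comap_rel, ← skip_skip h, insertPair_skip_skip]
  · rw [Setoid.comap_rel, skip_of_lt (by omega), skip_of_lt (by omega)]
    exact insertPair_self_succ
  · intro x
    rw [Setoid.comap_rel, ← skip_skip h, skip_of_lt (by omega)]
    exact not_insertPair_skip

lemma contract_insertPair_add_two (h : i ≤ j) :
    contract i (insertPair (j + 2) σ) = insertPair j (contract i σ) := by
  rw [contract, contract, ← comap_skip_insertPair_add_two h, insertPair_sup_pair,
    skip_of_lt (by omega), skip_of_lt (by omega)]

lemma contract_add_two_insertPair (h : j ≤ i) :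
    contract (i + 2) (insertPair j σ) = insertPair j (contract i σ) := by
  rw [contract, contract, ← comap_skip_add_two_insertPair h, insertPair_sup_pair,
    skip_of_le h, skip_of_le (by omega)]

/-- The number of blocks of the restriction of a partition to `{0, …, k - 1}`. -/
noncomputable def blocksBelow (k : ℕ) (τ : Setoid ℕ) : ℕ :=
  blockCount (τ.comap (Fin.val : Fin k → ℕ))

/-- The map of blocks that is induced by `skip i`. -/
def skipBlock {k : ℕ} (hi : i ≤ k) (τ : Setoid ℕ) :
    Quotient ((τ.comap (skip i)).comap (Fin.val : Fin k → ℕ)) →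
      Quotient (τ.comap (Fin.val : Fin (k + 2) → ℕ)) :=
  Quotient.map (fun x => ⟨skip i x, (skip_lt hi).2 x.2⟩) fun _ _ h => h

lemma skipBlock_injective {k : ℕ} (hi : i ≤ k) (τ : Setoid ℕ) :
    Function.Injective (skipBlock hi τ) := by
  rintro ⟨x⟩ ⟨y⟩ h
  exact Quotient.sound (Quotient.exact h : _)

lemma blocksBelow_add_two {k l : ℕ} (hi : i ≤ k) (h : τ i (i + 1)) (hl : l < k)
    (h' : τ i (skip i l)) : blocksBelow (k + 2) τ = blocksBelow k (τ.comap (skip i)) := by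
  refine (Nat.card_eq_of_bijective (skipBlock hi τ) ⟨skipBlock_injective hi τ, ?_⟩).symm
  rintro ⟨x, hx⟩
  rcases skip_cases i x with rfl | rfl | ⟨y, rfl⟩
  · exact ⟨Quotient.mk _ ⟨l, hl⟩, Quotient.sound (τ.symm h')⟩
  · exact ⟨Quotient.mk _ ⟨l, hl⟩, Quotient.sound (τ.symm (τ.trans (τ.symm h) h'))⟩
  · exact ⟨Quotient.mk _ ⟨y, (skip_lt hi).1 hx⟩, Quotient.sound (τ.refl _)⟩

lemma blocksBelow_insertPair {k : ℕ} (hi : i ≤ k) :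
    blocksBelow (k + 2) (insertPair i σ) = blocksBelow k σ + 1 := by
  have h := Finite.card_option
    (α := Quotient (((insertPair i σ).comap (skip i)).comap (Fin.val : Fin k → ℕ)))
  rw [comap_insertPair] at h
  rw [blocksBelow, blocksBelow, blockCount, blockCount, ← h]
  have hk : i < k + 2 := by omega
  let f : Option (Quotient (((insertPair i σ).comap (skip i)).comap (Fin.val : Fin k → ℕ))) →
      Quotient ((insertPair i σ).comap (Fin.val : Fin (k + 2) → ℕ)) := fun o =>
    o.elim (Quotient.mk _ ⟨i, hk⟩) (skipBlock hi _)
  have hf : Function.Bijective f := by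
    constructor
    · rintro (_ | ⟨⟨x⟩⟩) (_ | ⟨⟨y⟩⟩) hxy
      · rfl
      · exact absurd (Quotient.exact hxy) not_insertPair_skip
      · exact absurd (Quotient.exact hxy.symm) not_insertPair_skip
      · exact congrArg some (skipBlock_injective hi _ hxy)
    · rintro ⟨x, hx⟩
      rcases skip_cases i x with rfl | rfl | ⟨y, rfl⟩
      · exact ⟨none, rfl⟩
      · exact ⟨none, Quotient.sound insertPair_self_succ⟩
      · exact ⟨some (Quotient.mk _ ⟨y, (skip_lt hi).1 hx⟩), Quotient.sound (.inl rfl)⟩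
  have := Nat.card_eq_of_bijective f hf
  rw [comap_insertPair] at this
  exact this.symm

end

/-- The restriction of the partition to `{0, …, k - 1}` is a noncrossing pairing, and the other
points are singletons. -/
structure IsNCPairing (k : ℕ) (σ : Setoid ℕ) : Prop where
  partner : ∀ a < k, ∃ b < k, b ≠ a ∧ ∀ c, σ a c ↔ c = a ∨ c = b
  outside : ∀ a, k ≤ a → ∀ c, σ a c → c = a
  noncrossing : ∀ a b c d, a < b → b < c → c < d → σ a c → σ b d → σ a b

section

variable {σ τ : Setoid ℕ} {i k x c : ℕ}

lemma insertPair_left : insertPair i σ i c ↔ c = i ∨ c = i + 1 := by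
  refine ⟨fun h => ?_, ?_⟩
  · rcases skip_cases i c with h' | h' | ⟨y, rfl⟩
    · exact .inl h'
    · exact .inr h'
    · exact absurd h not_insertPair_skip
  · rintro (rfl | rfl)
    · exact .inl rfl
    · exact insertPair_self_succ

lemma insertPair_left_succ : insertPair i σ (i + 1) c ↔ c = i ∨ c = i + 1 := by
  rw [← insertPair_left (σ := σ)]
  exact ⟨Setoid.trans' _ insertPair_self_succ,
    Setoid.trans' _ (Setoid.symm' _ insertPair_self_succ)⟩

lemma insertPair_left_skip : insertPair i σ (skip i x) c ↔ ∃ y, c = skip i y ∧ σ x y := by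
  refine ⟨fun h => ?_, ?_⟩
  · rcases skip_cases i c with h' | h' | ⟨y, rfl⟩
    · subst h'
      exact absurd (Setoid.symm' _ h) not_insertPair_skip
    · subst h'
      exact absurd (insertPair_left_succ.1 (Setoid.symm' _ h))
        (not_or.2 ⟨skip_ne _ _, skip_ne_succ _ _⟩)
    · exact ⟨y, rfl, insertPair_skip_skip.1 h⟩
  · rintro ⟨y, rfl, h⟩
    exact insertPair_skip_skip.2 h

lemma IsNCPairing.insertPair (h : IsNCPairing k σ) (hi : i ≤ k) :
    IsNCPairing (k + 2) (insertPair i σ) where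
  partner a ha := by
    obtain h' | h' | ⟨x, rfl⟩ := skip_cases i a
    · subst h'
      exact ⟨a + 1, by omega, by omega, fun c => insertPair_left⟩
    · subst h'
      exact ⟨i, by omega, by omega, fun c => insertPair_left_succ.trans or_comm⟩
    · obtain ⟨y, hy, hne, hc⟩ := h.partner x ((skip_lt hi).1 ha)
      refine ⟨skip i y, (skip_lt hi).2 hy, (skip_injective i).ne hne, fun c => ?_⟩
      rw [insertPair_left_skip]
      simp only [hc]
      constructor
      · rintro ⟨z, rfl, rfl | rfl⟩ <;> simp
      · rintro (rfl | rfl)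
        exacts [⟨x, rfl, .inl rfl⟩, ⟨y, rfl, .inr rfl⟩]
  outside a ha c hc := by
    obtain h' | h' | ⟨x, rfl⟩ := skip_cases i a
    · omega
    · omega
    · obtain ⟨y, rfl, hy⟩ := insertPair_left_skip.1 hc
      rw [h.outside x (by have := (skip_lt (j := x) hi).2; omega) y hy]
  noncrossing a b c d hab hbc hcd hac hbd := by
    obtain h' | h' | ⟨x, rfl⟩ := skip_cases i a
    · subst h'
      have := insertPair_left.1 hac
      omega
    · subst h'
      have := insertPair_left_succ.1 hac
      omega
    obtain h' | h' | ⟨y, rfl⟩ := skip_cases i b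
    · subst h'
      have := insertPair_left.1 hbd
      omega
    · subst h'
      have := insertPair_left_succ.1 hbd
      omega
    obtain ⟨z, rfl, hz⟩ := insertPair_left_skip.1 hac
    obtain ⟨w, rfl, hw⟩ := insertPair_left_skip.1 hbd
    rw [(skip_strictMono i).lt_iff_lt] at hab hbc hcd
    exact insertPair_skip_skip.2 (h.noncrossing x y z w hab hbc hcd hz hw)

lemma IsNCPairing.of_insertPair (h : IsNCPairing (k + 2) (Meander.insertPair i σ)) (hi : i ≤ k) :
    IsNCPairing k σ where
  partner x hx := by
    obtain ⟨b, hb, hne, hc⟩ := h.partner (skip i x) ((skip_lt hi).2 hx)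
    obtain ⟨y, rfl, hy⟩ := insertPair_left_skip.1 ((hc b).2 (.inr rfl))
    refine ⟨y, (skip_lt hi).1 hb, fun hyx => hne (by rw [hyx]), fun c => ?_⟩
    rw [← insertPair_skip_skip (i := i), hc, (skip_injective i).eq_iff, (skip_injective i).eq_iff]
  outside x hx c hc := by
    have hx' : k + 2 ≤ skip i x := by
      have := (skip_lt (j := x) hi).1
      omega
    exact skip_injective i (h.outside _ hx' _ (insertPair_skip_skip.2 hc))
  noncrossing a b c d hab hbc hcd hac hbd :=
    insertPair_skip_skip.1 (h.noncrossing _ _ _ _ (skip_strictMono i hab) (skip_strictMono i hbc)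
      (skip_strictMono i hcd) (insertPair_skip_skip.2 hac) (insertPair_skip_skip.2 hbd))

lemma isNCPairing_bot : IsNCPairing 0 (⊥ : Setoid ℕ) where
  partner _ ha := absurd ha (Nat.not_lt_zero _)
  outside _ _ _ hc := hc.symm
  noncrossing a b c d hab hbc _ hac _ := by
    have : a = c := hac
    omega

lemma IsNCPairing.eq_insertPair (h : IsNCPairing k σ) (hi : i < k) (h' : σ i (i + 1)) :
    σ = Meander.insertPair i (σ.comap (skip i)) := by
  refine Meander.eq_insertPair h' fun x hx => ?_
  obtain ⟨b, -, -, hb⟩ := h.partner i hi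
  have h1 := (hb _).1 h'
  have h2 := (hb _).1 hx
  have h3 := skip_ne i x
  have h4 := skip_ne_succ i x
  omega

lemma IsNCPairing.exists_eq_insertPair (h : IsNCPairing (k + 2) σ) (hi : i ≤ k)
    (h' : σ i (i + 1)) : ∃ σ', IsNCPairing k σ' ∧ σ = Meander.insertPair i σ' := by
  have h1 := h.eq_insertPair (by omega) h'
  exact ⟨_, (h1 ▸ h).of_insertPair hi, h1⟩

end

/-- Insert an up step and a down step after the first `i` steps. -/
def peak : ℕ → List Bool → List Bool
  | 0, p => true :: false :: p
  | i + 1, s :: p => s :: peak i p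
  | _ + 1, [] => []

section

variable {F : Type*} [Field F] {P : ℕ → F} {n : F}

/-- A noncrossing pairing of `2 * m` points that is obtained by inserting blocks of neighbours, with
its walk and its vector. -/
inductive Diagram (P : ℕ → F) : ℕ → Setoid ℕ → List Bool → (List Bool → F) → Prop
  | nil : Diagram P 0 ⊥ [] (fun p => if p = [] then 1 else 0)
  | insert {m : ℕ} {σ : Setoid ℕ} {p : List Bool} {u : List Bool → F} {i : ℕ} (hi : i ≤ 2 * m) :
    Diagram P m σ p u → Diagram P (m + 1) (insertPair i σ) (peak i p) (cup P i 0 u)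

variable {m : ℕ} {σ τ : Setoid ℕ} {p q : List Bool} {u v : List Bool → F}

lemma Diagram.isNCPairing (h : Diagram P m σ p u) : IsNCPairing (2 * m) σ := by
  induction h with
  | nil => exact isNCPairing_bot
  | insert hi _ ih => exact ih.insertPair hi

open Classical in
lemma Diagram.exists_contract (hP : ∀ a, P a ≠ 0) (h0 : P 1 = n * P 0)
    (hrec : ∀ a, P (a + 2) = n * P (a + 1) - P a) (h : Diagram P (m + 1) σ p u) {i : ℕ}
    (hi : i ≤ 2 * m) :
    ∃ p' u', Diagram P m (contract i σ) p' u' ∧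
      ∀ q, StaysNonneg 0 q → q.length = 2 * m →
        cap P i 0 u q = (if σ i (i + 1) then n else 1) * u' q := by
  induction m generalizing σ p u i with
  | zero =>
    cases h with
    | @insert _ σ p u j hj hd =>
      obtain rfl : i = 0 := by omega
      obtain rfl : j = 0 := by omega
      rw [contract_insertPair_self, if_pos insertPair_self_succ]
      exact ⟨p, u, hd, fun q hq hl => cap_cup_self hP h0 hrec 0 u hq (by omega)⟩
  | succ m ih =>
    cases h with
    | @insert _ σ p u j hj hd =>
      obtain hij | hij | hij | hij | hij :
        i = j ∨ j = i + 1 ∨ i = j + 1 ∨ (∃ l, i ≤ l ∧ j = l + 2) ∨ ∃ l, j ≤ l ∧ i = l + 2 := by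
          rcases lt_trichotomy i j with h | h | h
          · by_cases h' : j = i + 1
            · exact .inr (.inl h')
            · exact .inr (.inr (.inr (.inl ⟨j - 2, by omega, by omega⟩)))
          · exact .inl h
          · by_cases h' : i = j + 1
            · exact .inr (.inr (.inl h'))
            · exact .inr (.inr (.inr (.inr ⟨i - 2, by omega, by omega⟩)))
      · subst hij
        rw [contract_insertPair_self, if_pos insertPair_self_succ]
        exact ⟨p, u, hd, fun q hq hl => cap_cup_self hP h0 hrec i u hq (by omega)⟩
      · subst hij
        rw [contract_insertPair_succ, if_neg]
        · refine ⟨p, u, hd, fun q hq hl => ?_⟩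
          rw [one_mul, cap_cup_succ hP i u hq (by omega)]
        · intro h
          have := insertPair_left.1 (Setoid.symm' _ h)
          omega
      · subst hij
        rw [contract_succ_insertPair, if_neg]
        · refine ⟨p, u, hd, fun q hq hl => ?_⟩
          rw [one_mul, cap_succ_cup hP j u hq (by omega)]
        · intro h
          have := insertPair_left_succ.1 h
          omega
      · obtain ⟨l, hl, rfl⟩ := hij
        obtain ⟨p', u', hd', hu'⟩ := ih hd (i := i) (by omega)
        refine ⟨_, _, contract_insertPair_add_two hl ▸ hd'.insert (by omega), fun q hq hql => ?_⟩
        rw [cap_cup_of_le hl u hq (by omega), cup_congr (fun r hr hrl => hu' r hr (by omega)) hq,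
          cup_const_mul]
        congr 2
        have := insertPair_skip_skip (i := l + 2) (σ := σ) (x := i) (y := i + 1)
        rw [skip_of_lt (by omega), skip_of_lt (by omega)] at this
        exact propext this.symm
      · obtain ⟨l, hl, rfl⟩ := hij
        obtain ⟨p', u', hd', hu'⟩ := ih hd (i := l) (by omega)
        refine ⟨_, _, contract_add_two_insertPair hl ▸ hd'.insert (by omega), fun q hq hql => ?_⟩
        rw [cap_add_two_cup hl u hq (by omega), cup_congr (fun r hr hrl => hu' r hr (by omega)) hq,
          cup_const_mul]
        congr 2
        have := insertPair_skip_skip (i := j) (σ := σ) (x := l) (y := l + 1)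
        rw [skip_of_le hl, skip_of_le (by omega)] at this
        exact propext this.symm

open Classical in
lemma blocksBelow_insertPair_sup {k i : ℕ} (hτ : IsNCPairing (k + 2) τ) (hi : i ≤ k) :
    blocksBelow (k + 2) (insertPair i σ ⊔ τ) =
      blocksBelow k (σ ⊔ contract i τ) + if τ i (i + 1) then 1 else 0 := by
  split_ifs with h
  · obtain ⟨τ, -, rfl⟩ := hτ.exists_eq_insertPair hi h
    rw [← insertPair_sup, blocksBelow_insertPair hi, contract_insertPair_self]
  · obtain ⟨b, hb, hne, hc⟩ := hτ.partner i (by omega)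
    have hib := (hc b).2 (.inr rfl)
    obtain h' | h' | ⟨l, rfl⟩ := skip_cases i b
    · omega
    · exact absurd (h' ▸ hib) h
    · rw [add_zero, ← comap_skip_insertPair_sup]
      refine blocksBelow_add_two hi ?_ ((skip_lt hi).1 hb) ?_
      · exact (le_sup_left : insertPair i σ ≤ insertPair i σ ⊔ τ) insertPair_self_succ
      · exact (le_sup_right : τ ≤ insertPair i σ ⊔ τ) hib

theorem Diagram.sum_weight_mul (hP : ∀ a, P a ≠ 0) (h0 : P 1 = n * P 0)
    (hrec : ∀ a, P (a + 2) = n * P (a + 1) - P a) (h : Diagram P m σ p u)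
    (h' : Diagram P m τ q v) :
    ∑ r ∈ paths (2 * m) 0, weight P 0 r * u r * v r = n ^ blocksBelow (2 * m) (σ ⊔ τ) := by
  classical
  induction h generalizing τ q v with
  | nil =>
    cases h'
    have : blocksBelow (2 * 0) ((⊥ : Setoid ℕ) ⊔ ⊥) = 0 := by
      rw [blocksBelow, blockCount, Nat.card_eq_zero]
      left
      exact ⟨by rintro ⟨x, hx⟩; omega⟩
    rw [this]
    simp [paths, weight]
  | @insert m σ p u i hi hd ih =>
    obtain ⟨p', u', hd', hu'⟩ := h'.exists_contract hP h0 hrec hi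
    rw [show 2 * (m + 1) = 2 * m + 2 from rfl, sum_weight_mul_cup hP hi,
      blocksBelow_insertPair_sup (k := 2 * m) h'.isNCPairing hi, pow_add, ← ih hd', Finset.sum_mul]
    refine Finset.sum_congr rfl fun r hr => ?_
    rw [hu' r (staysNonneg_of_mem_paths hr) (length_of_mem_paths hr)]
    split_ifs <;> ring

end

section

variable {i k a : ℕ} {p q : List Bool}

lemma peak_mem_paths (h : p ∈ paths k a) (hi : i ≤ k) : peak i p ∈ paths (k + 2) a := by
  induction i generalizing k a p with
  | zero => simpa [peak] using h
  | succ i ih =>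
    obtain ⟨k, rfl⟩ : ∃ l, k = l + 1 := ⟨k - 1, by omega⟩
    rcases a with _ | a <;> rcases p with _ | ⟨_ | _, p⟩
    · simpa using length_of_mem_paths h
    · simp at h
    · rw [true_cons_mem_paths] at h
      rw [peak, true_cons_mem_paths]
      exact ih h (by omega)
    · simpa using length_of_mem_paths h
    · rw [false_cons_mem_paths] at h
      rw [peak, false_cons_mem_paths]
      exact ih h (by omega)
    · rw [true_cons_mem_paths] at h
      rw [peak, true_cons_mem_paths]
      exact ih h (by omega)

lemma exists_eq_peak_of_mem_paths_succ (h : p ∈ paths (k + 1) (a + 1)) :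
    ∃ i q, true :: p = peak i q ∧ q ∈ paths k a ∧ i ≤ k := by
  induction k generalizing a p with
  | zero =>
    rcases p with _ | ⟨_ | _, p⟩
    · simpa using length_of_mem_paths h
    · exact ⟨0, p, rfl, by simpa using h, le_rfl⟩
    · simp [paths] at h
  | succ k ih =>
    rcases p with _ | ⟨_ | _, p⟩
    · simpa using length_of_mem_paths h
    · exact ⟨0, p, rfl, by simpa using h, Nat.zero_le _⟩
    · obtain ⟨i, q, hpq, hq, hi⟩ := ih (true_cons_mem_paths.1 h)
      exact ⟨i + 1, true :: q, by rw [hpq, peak], true_cons_mem_paths.2 hq, by omega⟩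

lemma exists_eq_peak (h : p ∈ paths (k + 2) 0) : ∃ i q, p = peak i q ∧ q ∈ paths k 0 ∧ i ≤ k := by
  rcases p with _ | ⟨_ | _, p⟩
  · simpa using length_of_mem_paths h
  · simp at h
  · exact exists_eq_peak_of_mem_paths_succ (true_cons_mem_paths.1 h)

lemma getElem?_peak_skip (h : i ≤ p.length) (j : ℕ) : (peak i p)[skip i j]? = p[j]? := by
  induction i generalizing p j with
  | zero => simp [peak, skip]
  | succ i ih =>
    rcases p with _ | ⟨s, p⟩
    · simp at h
    · rcases j with _ | j
      · simp [peak, skip]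
      · have : skip (i + 1) (j + 1) = skip i j + 1 := by
          unfold skip; split_ifs <;> omega
        rw [this, peak, List.getElem?_cons_succ, List.getElem?_cons_succ]
        exact ih (by simpa using h) j

lemma getElem?_peak_self (h : i ≤ p.length) :
    (peak i p)[i]? = some true ∧ (peak i p)[i + 1]? = some false := by
  induction i generalizing p with
  | zero => simp [peak]
  | succ i ih =>
    rcases p with _ | ⟨s, p⟩
    · simp at h
    · simpa [peak] using ih (by simpa using h)

end

/-- The point `j` is equivalent to a larger one. -/
def Opens (σ : Setoid ℕ) (j : ℕ) : Prop := ∃ l, j < l ∧ σ j l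

section

variable {σ τ : Setoid ℕ} {i j k : ℕ}

lemma opens_insertPair_self : Opens (insertPair i σ) i :=
  ⟨i + 1, by omega, insertPair_self_succ⟩

lemma not_opens_insertPair_succ : ¬ Opens (insertPair i σ) (i + 1) := by
  rintro ⟨l, hl, h⟩
  have := insertPair_left_succ.1 h
  omega

lemma opens_insertPair_skip : Opens (insertPair i σ) (skip i j) ↔ Opens σ j := by
  constructor
  · rintro ⟨l, hl, h⟩
    obtain ⟨y, rfl, hy⟩ := insertPair_left_skip.1 h
    exact ⟨y, (skip_strictMono i).lt_iff_lt.1 hl, hy⟩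
  · rintro ⟨l, hl, h⟩
    exact ⟨skip i l, skip_strictMono i hl, insertPair_skip_skip.2 h⟩

lemma IsNCPairing.rel_succ (h : IsNCPairing k σ) (hi : i + 1 < k) (h1 : Opens σ i)
    (h2 : ¬ Opens σ (i + 1)) : σ i (i + 1) := by
  obtain ⟨l, hl, hil⟩ := h1
  obtain ⟨b, -, hne, hb⟩ := h.partner (i + 1) hi
  have hib := (hb b).2 (.inr rfl)
  have hbi : b < i + 1 := by
    by_contra hbi
    exact h2 ⟨b, by omega, hib⟩
  by_contra hcon
  have hli : l ≠ i + 1 := fun hli => hcon (hli ▸ hil)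
  have hbi' : b ≠ i := fun hbi' => hcon (σ.symm (hbi' ▸ hib))
  have h3 := h.noncrossing b i (i + 1) l (by omega) (by omega) (by omega) (σ.symm hib) hil
  exact hcon (σ.symm (σ.trans hib h3))

lemma IsNCPairing.exists_rel_succ (h : IsNCPairing k σ) (hk : k ≠ 0) :
    ∃ l i, k = l + 2 ∧ i ≤ l ∧ σ i (i + 1) := by
  have hlast : ¬ Opens σ (k - 1) := by
    rintro ⟨l, hl, hkl⟩
    have := h.outside l (by omega) _ (σ.symm hkl)
    omega
  classical
  have hex : ∃ j, ¬ Opens σ j := ⟨_, hlast⟩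
  have h0 : Nat.find hex ≠ 0 := by
    intro h0
    have h1 := Nat.find_spec hex
    rw [h0] at h1
    obtain ⟨b, -, hne, hb⟩ := h.partner 0 (by omega)
    exact h1 ⟨b, by omega, (hb b).2 (.inr rfl)⟩
  have hle : Nat.find hex ≤ k - 1 := Nat.find_min' hex hlast
  obtain ⟨i, hi⟩ : ∃ i, Nat.find hex = i + 1 := ⟨Nat.find hex - 1, by omega⟩
  refine ⟨k - 2, i, by omega, by omega, h.rel_succ (by omega) ?_ ?_⟩
  · exact not_not.1 (Nat.find_min hex (m := i) (by omega))
  · rw [← hi]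
    exact Nat.find_spec hex

lemma IsNCPairing.eq_bot (h : IsNCPairing 0 σ) : σ = ⊥ := by
  ext a b
  exact ⟨fun hab => (h.outside a (Nat.zero_le _) b hab).symm, fun hab => hab ▸ σ.refl _⟩

lemma IsNCPairing.eq_of_opens (h : IsNCPairing k σ) (h' : IsNCPairing k τ)
    (ho : ∀ j, Opens σ j ↔ Opens τ j) : σ = τ := by
  induction k using Nat.strong_induction_on generalizing σ τ with
  | _ k ih =>
    by_cases hk : k = 0
    · subst hk
      rw [h.eq_bot, h'.eq_bot]
    · obtain ⟨l, i, rfl, hi, hrel⟩ := h.exists_rel_succ hk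
      obtain ⟨σ, hσ, rfl⟩ := h.exists_eq_insertPair hi hrel
      have hrel' : τ i (i + 1) := h'.rel_succ (by omega) ((ho _).1 opens_insertPair_self)
        fun h1 => not_opens_insertPair_succ ((ho _).2 h1)
      obtain ⟨τ, hτ, rfl⟩ := h'.exists_eq_insertPair hi hrel'
      congr 1
      refine ih l (by omega) hσ hτ fun j => ?_
      rw [← opens_insertPair_skip (i := i), ho, opens_insertPair_skip]

end

section

variable {F : Type*} [Field F] {P : ℕ → F} {m k i a : ℕ} {σ τ : Setoid ℕ} {p q : List Bool}
  {u v : List Bool → F}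

lemma Diagram.mem_paths (h : Diagram P m σ p u) : p ∈ paths (2 * m) 0 := by
  induction h with
  | nil => simp [paths]
  | insert hi _ ih => exact peak_mem_paths ih hi

lemma Diagram.getElem?_eq (h : Diagram P m σ p u) (j : ℕ) : p[j]? = some true ↔ Opens σ j := by
  induction h generalizing j with
  | nil =>
    simp only [List.getElem?_nil, reduceCtorEq, false_iff]
    rintro ⟨l, hl, h⟩
    exact hl.ne h
  | @insert m σ p u i hi hd ih =>
    have hl : i ≤ p.length := by rwa [length_of_mem_paths hd.mem_paths]
    obtain h' | h' | ⟨x, rfl⟩ := skip_cases i j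
    · subst h'
      simp [getElem?_peak_self hl, opens_insertPair_self]
    · subst h'
      simp [getElem?_peak_self hl, not_opens_insertPair_succ]
    · rw [getElem?_peak_skip hl, ih, opens_insertPair_skip]

lemma Diagram.eq_of_path_eq (h : Diagram P m σ p u) (h' : Diagram P m τ p v) : σ = τ :=
  h.isNCPairing.eq_of_opens h'.isNCPairing fun j => by rw [← h.getElem?_eq, h'.getElem?_eq]

lemma Diagram.path_eq (h : Diagram P m σ p u) (h' : Diagram P m σ q v) : p = q := by
  have hp := length_of_mem_paths h.mem_paths
  have hq := length_of_mem_paths h'.mem_paths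
  refine List.ext_getElem (hp.trans hq.symm) fun j h1 h2 => ?_
  have := (h.getElem?_eq j).trans (h'.getElem?_eq j).symm
  rw [List.getElem?_eq_getElem h1, List.getElem?_eq_getElem h2] at this
  rwa [Option.some_inj, Option.some_inj, ← Bool.eq_iff_iff] at this

lemma IsNCPairing.exists_diagram (P : ℕ → F) (h : IsNCPairing k σ) :
    ∃ m p u, k = 2 * m ∧ Diagram P m σ p u := by
  induction k using Nat.strong_induction_on generalizing σ with
  | _ k ih =>
    by_cases hk : k = 0
    · subst hk
      exact ⟨0, _, _, rfl, h.eq_bot ▸ Diagram.nil⟩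
    · obtain ⟨l, i, rfl, hi, hrel⟩ := h.exists_rel_succ hk
      obtain ⟨σ, hσ, rfl⟩ := h.exists_eq_insertPair hi hrel
      obtain ⟨m, p, u, rfl, hd⟩ := ih l (by omega) hσ
      exact ⟨m + 1, _, _, rfl, hd.insert hi⟩

lemma exists_diagram_of_mem_paths (P : ℕ → F) (h : p ∈ paths (2 * m) 0) :
    ∃ σ u, Diagram P m σ p u := by
  induction m generalizing p with
  | zero =>
    obtain rfl : p = [] := by simpa [paths] using h
    exact ⟨_, _, .nil⟩
  | succ m ih =>
    obtain ⟨i, q, rfl, hq, hi⟩ := exists_eq_peak (k := 2 * m) h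
    obtain ⟨σ, u, hd⟩ := ih hq
    exact ⟨_, _, hd.insert hi⟩

lemma cup_peak (hp : StaysNonneg a p) (hi : i ≤ p.length) : cup P i a u (peak i p) = u p := by
  induction i generalizing a p u with
  | zero => simp [peak, cup]
  | succ i ih =>
    rcases a with _ | a <;> rcases p with _ | ⟨_ | _, p⟩ <;>
      simp only [StaysNonneg, List.length_nil, List.length_cons, Nat.add_le_add_iff_right] at hp hi
    all_goals first
      | exact ih hp hi
      | omega

lemma cup_eq_zero_of_lt (h : ∀ q, p < q → u q = 0) (hi : i ≤ p.length) (hq : peak i p < q) :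
    cup P i a u q = 0 := by
  induction i generalizing a p q u with
  | zero =>
    rcases a with _ | a <;> rcases q with _ | ⟨_ | _, _ | ⟨_ | _, q⟩⟩ <;>
      simp_all [peak, cup, List.cons_lt_cons_iff]
    exact absurd hq (by decide)
  | succ i ih =>
    rcases p with _ | ⟨s, p⟩
    · simp at hi
    rcases q with _ | ⟨t, q⟩
    · simp [cup]
    have key : ∀ b, cup P i b (fun r => u (t :: r)) q = 0 := by
      intro b
      rw [peak, List.cons_lt_cons_iff] at hq
      rcases hq with hst | ⟨rfl, hq⟩
      · rw [show (fun r => u (t :: r)) = fun _ => 0 from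
          funext fun r => h _ (List.cons_lt_cons_iff.2 (.inl hst))]
        exact cup_zero_right _ _ _
      · exact ih (fun r hr => h _ (List.cons_lt_cons_iff.2 (.inr ⟨rfl, hr⟩))) (by simpa using hi) hq
    rcases a with _ | a <;> rcases t with _ | _ <;> simp only [cup, key]

lemma Diagram.apply_self (h : Diagram P m σ p u) : u p = 1 := by
  induction h with
  | nil => simp
  | insert hi hd ih =>
    rw [cup_peak (staysNonneg_of_mem_paths hd.mem_paths), ih]
    rwa [length_of_mem_paths hd.mem_paths]

lemma Diagram.apply_eq_zero_of_lt (h : Diagram P m σ p u) (hq : p < q) : u q = 0 := by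
  induction h generalizing q with
  | nil => exact if_neg (by rintro rfl; exact lt_irrefl _ hq)
  | insert hi hd ih =>
    exact cup_eq_zero_of_lt (fun r hr => ih hr) (by rwa [length_of_mem_paths hd.mem_paths]) hq

end

/-- The extension of a partition of `{0, …, k - 1}` to the natural numbers by singletons. -/
def extend {k : ℕ} (π : Setoid (Fin k)) : Setoid ℕ where
  r u v := u = v ∨ ∃ a b : Fin k, u = a ∧ v = b ∧ π a b
  iseqv := by
    refine ⟨fun _ => .inl rfl, ?_, ?_⟩
    · rintro u v (h | ⟨a, b, hu, hv, h⟩)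
      · exact .inl h.symm
      · exact .inr ⟨b, a, hv, hu, π.symm h⟩
    · rintro u v w (rfl | ⟨a, b, rfl, rfl, h⟩) (rfl | ⟨c, d, hc, rfl, h'⟩)
      · exact .inl rfl
      · exact .inr ⟨c, d, hc, rfl, h'⟩
      · exact .inr ⟨a, b, rfl, rfl, h⟩
      · obtain rfl := Fin.val_injective hc
        exact .inr ⟨a, d, rfl, rfl, π.trans h h'⟩

section

variable {k : ℕ} {π ρ : Setoid (Fin k)} {σ : Setoid ℕ}

lemma extend_le_iff : extend π ≤ σ ↔ π ≤ σ.comap Fin.val := by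
  refine ⟨fun h a b hab => h (.inr ⟨a, b, rfl, rfl, hab⟩), ?_⟩
  rintro h u v (rfl | ⟨a, b, rfl, rfl, hab⟩)
  exacts [σ.refl _, h hab]

@[simp] lemma extend_coe_coe {a b : Fin k} : extend π a b ↔ π a b := by
  constructor
  · rintro (h | ⟨c, d, hc, hd, h⟩)
    · rw [Fin.val_injective h]
    · rwa [Fin.val_injective hc, Fin.val_injective hd]
  · exact fun h => .inr ⟨a, b, rfl, rfl, h⟩

lemma comap_extend : (extend π).comap Fin.val = π := by
  ext a b
  exact extend_coe_coe

lemma extend_injective : Function.Injective (extend : Setoid (Fin k) → Setoid ℕ) := by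
  intro π ρ h
  rw [← comap_extend (π := π), h, comap_extend]

lemma extend_sup : extend (π ⊔ ρ) = extend π ⊔ extend ρ := by
  refine eq_of_forall_ge_iff fun σ => ?_
  simp only [extend_le_iff, sup_le_iff]

lemma blocksBelow_extend : blocksBelow k (extend π) = blockCount π := by
  rw [blocksBelow, comap_extend]

lemma isNCPairing_extend (π : NCPairing k) : IsNCPairing k (extend π.1) where
  partner a ha := by
    have hcard := π.2.1 ⟨a, ha⟩
    obtain ⟨b, hb, hne⟩ := Set.exists_ne_of_one_lt_ncard (s := {b | π.1 ⟨a, ha⟩ b})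
      (by omega) ⟨a, ha⟩
    have hset : ({⟨a, ha⟩, b} : Set (Fin k)) = {b | π.1 ⟨a, ha⟩ b} := by
      refine Set.eq_of_subset_of_ncard_le ?_ ?_
      · rintro x (rfl | rfl)
        exacts [π.1.refl _, hb]
      · rw [hcard, Set.ncard_pair hne.symm]
    refine ⟨b, b.2, fun h => hne (Fin.ext h), fun c => ?_⟩
    constructor
    · rintro (rfl | ⟨x, y, hx, rfl, h⟩)
      · exact .inl rfl
      · obtain rfl : x = ⟨a, ha⟩ := Fin.ext hx.symm
        have : y ∈ ({⟨a, ha⟩, b} : Set (Fin k)) := hset ▸ h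
        rcases this with rfl | rfl
        exacts [.inl rfl, .inr rfl]
    · rintro (rfl | rfl)
      · exact .inl rfl
      · exact .inr ⟨⟨a, ha⟩, b, rfl, rfl, hb⟩
  outside a ha c hc := by
    rcases hc with rfl | ⟨x, y, rfl, -⟩
    · rfl
    · omega
  noncrossing a b c d hab hbc hcd hac hbd := by
    rcases hac with rfl | ⟨a, c, rfl, rfl, hac⟩
    · omega
    rcases hbd with rfl | ⟨b, d, rfl, rfl, hbd⟩
    · omega
    exact extend_coe_coe.2 (π.2.2 a b c d hab hbc hcd hac hbd)

lemma IsNCPairing.exists_extend_eq (h : IsNCPairing k σ) : ∃ π : NCPairing k, extend π.1 = σ := by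
  refine ⟨⟨σ.comap Fin.val, fun a => ?_, fun a b c d hab hbc hcd hac hbd =>
    h.noncrossing a b c d hab hbc hcd hac hbd⟩, ?_⟩
  · obtain ⟨b, hb, hne, hc⟩ := h.partner a a.2
    rw [Set.ncard_eq_two]
    refine ⟨a, ⟨b, hb⟩, fun h => hne (congrArg Fin.val h).symm, ?_⟩
    ext c
    simp [Setoid.comap_rel, hc, Fin.ext_iff]
  · ext u v
    constructor
    · rintro (rfl | ⟨a, b, rfl, rfl, h'⟩)
      exacts [σ.refl _, h']
    · intro huv
      by_cases hu : u < k
      · by_cases hv : v < k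
        · exact .inr ⟨⟨u, hu⟩, ⟨v, hv⟩, rfl, rfl, huv⟩
        · exact .inl (h.outside v (by omega) u (σ.symm huv))
      · exact .inl (h.outside u (by omega) v huv).symm

lemma isEmpty_ncPairing_of_odd (hk : Odd k) : IsEmpty (NCPairing k) := by
  refine ⟨fun π => ?_⟩
  obtain ⟨m, -, -, rfl, -⟩ := (isNCPairing_extend π).exists_diagram (fun _ => (0 : ℚ))
  exact Nat.not_odd_iff_even.2 (even_two_mul m) hk

end

theorem det_gramMatrix_eq_prod_weight {F : Type*} [Field F] {P : ℕ → F} {n : F}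
    (hP : ∀ a, P a ≠ 0) (h0 : P 1 = n * P 0) (hrec : ∀ a, P (a + 2) = n * P (a + 1) - P a)
    (m : ℕ) : (gramMatrix (2 * m) n).det = ∏ p ∈ paths (2 * m) 0, weight P 0 p := by
  have hex : ∀ π : NCPairing (2 * m), ∃ p u, Diagram P m (extend π.1) p u := by
    intro π
    obtain ⟨l, p, u, hl, hd⟩ := (isNCPairing_extend π).exists_diagram P
    obtain rfl : m = l := by omega
    exact ⟨p, u, hd⟩
  choose path vec hd using hex
  have hinj : Function.Injective path := fun π ρ h =>
    Subtype.ext (extend_injective ((hd π).eq_of_path_eq (h ▸ hd ρ)))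
  have himage : Finset.univ.map ⟨path, hinj⟩ = paths (2 * m) 0 := by
    ext p
    simp only [Finset.mem_map, Finset.mem_univ, true_and, Function.Embedding.coeFn_mk]
    constructor
    · rintro ⟨π, rfl⟩
      exact (hd π).mem_paths
    · intro hp
      obtain ⟨σ, u, hσ⟩ := exists_diagram_of_mem_paths P hp
      obtain ⟨π, rfl⟩ := hσ.isNCPairing.exists_extend_eq
      refine ⟨π, ?_⟩
      exact (hd π).path_eq hσ
  let U : Matrix (NCPairing (2 * m)) (NCPairing (2 * m)) F := Matrix.of fun π ρ => vec π (path ρ)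
  have hgram : gramMatrix (2 * m) n =
      U * Matrix.diagonal (fun ρ => weight P 0 (path ρ)) * U.transpose := by
    ext π ρ
    rw [Matrix.mul_apply, gramMatrix, Matrix.of_apply, ← blocksBelow_extend, extend_sup,
      ← (hd π).sum_weight_mul hP h0 hrec (hd ρ), ← himage, Finset.sum_map]
    refine Finset.sum_congr rfl fun κ _ => ?_
    rw [Matrix.mul_diagonal]
    simp only [U, Matrix.of_apply, Matrix.transpose_apply, Function.Embedding.coeFn_mk]
    ring
  have hU : U.det = 1 := by
    let _ : LinearOrder (NCPairing (2 * m)) := LinearOrder.lift' path hinj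
    rw [Matrix.det_of_isLowerTriangular]
    · exact Finset.prod_eq_one fun π _ => (hd π).apply_self
    · intro π ρ h
      exact (hd π).apply_eq_zero_of_lt h
  rw [hgram, Matrix.det_mul, Matrix.det_mul, Matrix.det_transpose, hU, Matrix.det_diagonal,
    ← himage, Finset.prod_map]
  simp

/-- The number of walks of `k` steps `±1` from `0` to `h` on the integers. -/
def walkCount : ℕ → ℤ → ℤ
  | 0, h => if h = 0 then 1 else 0
  | k + 1, h => walkCount k (h - 1) + walkCount k (h + 1)

lemma walkCount_neg (k : ℕ) (h : ℤ) : walkCount k (-h) = walkCount k h := by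
  induction k generalizing h with
  | zero => simp [walkCount]
  | succ k ih =>
    rw [walkCount, walkCount, ← ih (h - 1), ← ih (h + 1), add_comm]
    ring_nf

lemma intChoose_natCast_add_one (k : ℕ) (j : ℤ) :
    intChoose (k + 1 : ℕ) j = intChoose k (j - 1) + intChoose k j := by
  rcases lt_trichotomy j 0 with hj | rfl | hj
  · simp [intChoose, hj.not_ge, show ¬ 1 ≤ j by omega]
  · simp [intChoose]
  · obtain ⟨l, rfl⟩ : ∃ l : ℕ, j = l + 1 := ⟨(j - 1).toNat, by omega⟩
    have h1 : (0 : ℤ) ≤ l + 1 := by omega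
    have h2 : ((l : ℤ) + 1).toNat = l + 1 := by omega
    simp only [intChoose, h1, h2, add_sub_cancel_right, Nat.cast_nonneg, if_true, Int.toNat_natCast,
      Ring.choose_natCast, Nat.choose_succ_succ]
    push_cast
    rfl

lemma walkCount_sub_two_mul (k : ℕ) (j : ℤ) : walkCount k (k - 2 * j) = intChoose k j := by
  induction k generalizing j with
  | zero =>
    rcases lt_trichotomy j 0 with hj | rfl | hj
    · simp [walkCount, intChoose, hj.ne, hj.not_ge]
    · simp [walkCount, intChoose]
    · have h1 : 0 < j.toNat := by omega
      have := Ring.choose_natCast (R := ℤ) 0 j.toNat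
      rw [Nat.choose_eq_zero_of_lt h1] at this
      simp only [walkCount, intChoose, hj.le, if_true, Nat.cast_zero] at this ⊢
      rw [this, if_neg (by omega)]
  | succ k ih =>
    rw [walkCount, intChoose_natCast_add_one, ← ih, ← ih, add_comm]
    push_cast
    ring_nf

lemma card_paths (k a : ℕ) :
    ((paths k a).card : ℤ) = walkCount k a - walkCount k (a + 2) := by
  induction k generalizing a with
  | zero =>
    rcases a with _ | a
    · simp [paths, walkCount]
    · have h1 : (a : ℤ) + 1 ≠ 0 := by omega
      have h2 : (a : ℤ) + 1 + 2 ≠ 0 := by omega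
      simp [paths, walkCount, h1, h2]
  | succ k ih =>
    have h1 : ((paths k 1).card : ℤ) = walkCount k 1 - walkCount k 3 := by simpa using ih 1
    rcases a with _ | a
    · have h2 := walkCount_neg k 1
      simp only [paths, Finset.card_map, walkCount, h1]
      norm_num
      linarith
    · have h2 := ih (a + 2)
      have h3 := ih a
      rw [paths, Finset.card_disjUnion, Finset.card_map, Finset.card_map]
      push_cast at h2 ⊢
      rw [h2, h3, walkCount, walkCount]
      ring_nf

/-- The total number of steps up from `r - 1` to `r` in the elements of `paths k a`, for `1 ≤ r`. -/
def upCount (k : ℕ) (a r : ℤ) : ℤ :=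
  if a < r then walkCount k (2 * r - a) - walkCount k (2 * r + a + 2)
  else walkCount k (a + 2) - walkCount k (2 * r + a + 2)

lemma upCount_neg_one (k : ℕ) {r : ℤ} (hr : 0 ≤ r) : upCount k (-1) r = 0 := by
  rw [upCount, if_pos (by omega)]
  ring_nf

lemma upCount_zero {a r : ℤ} (ha : 0 ≤ a) (hr : 1 ≤ r) : upCount 0 a r = 0 := by
  unfold upCount walkCount
  split_ifs <;> omega

lemma upCount_succ (k : ℕ) (a r : ℤ) :
    upCount (k + 1) a r = upCount k (a - 1) r + upCount k (a + 1) r +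
      if r = a + 1 then walkCount k r - walkCount k (r + 2) else 0 := by
  rcases lt_trichotomy r (a + 1) with h | rfl | h
  · by_cases h' : r = a
    · subst h'
      simp only [upCount, walkCount, lt_self_iff_false, if_false, h.ne, sub_lt_self_iff,
        zero_lt_one, if_true, h.not_gt]
      ring_nf
    · simp only [upCount, walkCount, show ¬ a < r by omega, if_false, h.ne,
        show ¬ a - 1 < r by omega, show ¬ a + 1 < r by omega]
      ring_nf
  · simp only [upCount, walkCount, lt_self_iff_false, if_false, if_true, lt_add_one,
      show a - 1 < a + 1 by omega]
    ring_nf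
  · simp only [upCount, walkCount, show a < r by omega, if_false, h.ne', if_true,
      show a - 1 < r by omega, show a + 1 < r by omega]
    ring_nf

section

variable {F : Type*} [Field F] {P : ℕ → F}

lemma prod_weight_paths (hP : ∀ a, P a ≠ 0) {k a N : ℕ} (hN : a + k ≤ N) :
    ∏ p ∈ paths k a, weight P a p =
      ∏ r ∈ Finset.range N, (P (r + 1) / P r) ^ upCount k a (r + 1) := by
  have hQ : ∀ r, P (r + 1) / P r ≠ 0 := fun r => div_ne_zero (hP _) (hP _)
  induction k generalizing a with
  | zero =>
    rw [Finset.prod_eq_one, Finset.prod_eq_one]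
    · intro r _
      rw [upCount_zero (by omega) (by omega), zpow_zero]
    · intro p hp
      rw [List.length_eq_zero_iff.1 (length_of_mem_paths hp), weight]
  | succ k ih =>
    have hsplit : ∏ r ∈ Finset.range N, (P (r + 1) / P r) ^ upCount (k + 1) a (r + 1) =
        (P (a + 1) / P a) ^ (paths k (a + 1)).card *
          (∏ r ∈ Finset.range N, (P (r + 1) / P r) ^ upCount k (a + 1 : ℕ) (r + 1)) *
            ∏ r ∈ Finset.range N, (P (r + 1) / P r) ^ upCount k (a - 1) (r + 1) := by
      have hmem : a ∈ Finset.range N := Finset.mem_range.2 (by omega)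
      rw [← Finset.prod_ite_eq_of_mem' (Finset.range N) a
        (fun r => (P (r + 1) / P r) ^ (paths k (a + 1)).card) hmem, ← Finset.prod_mul_distrib,
        ← Finset.prod_mul_distrib]
      refine Finset.prod_congr rfl fun r _ => ?_
      rw [upCount_succ, zpow_add₀ (hQ r), zpow_add₀ (hQ r)]
      by_cases h : r = a
      · subst h
        rw [if_pos rfl, if_pos rfl, ← zpow_natCast, card_paths]
        push_cast
        ring
      · rw [if_neg h, if_neg (by omega), zpow_zero]
        push_cast
        ring
    rw [hsplit]
    rcases a with _ | a
    · rw [prod_paths_zero]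
      simp only [weight, Finset.prod_mul_distrib, Finset.prod_const]
      rw [ih (a := 1) (by omega)]
      have : ∏ r ∈ Finset.range N, (P (r + 1) / P r) ^ upCount k ((0 : ℕ) - 1) (r + 1) = 1 :=
        Finset.prod_eq_one fun r _ => by
          rw [Nat.cast_zero, zero_sub, upCount_neg_one k (by omega), zpow_zero]
      rw [this, mul_one]
    · rw [prod_paths_succ]
      simp only [weight, Finset.prod_mul_distrib, Finset.prod_const]
      rw [ih (a := a + 2) (by omega), ih (a := a) (by omega)]
      rw [show ((a + 1 : ℕ) : ℤ) - 1 = a by push_cast; ring]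

lemma prod_div_zpow (hP : ∀ a, P a ≠ 0) (h0 : P 0 = 1) (e : ℤ → ℤ) (N : ℕ) :
    ∏ r ∈ Finset.range N, (P (r + 1) / P r) ^ e (r + 1) =
      (∏ r ∈ Finset.Icc 1 N, P r ^ (e r - e (r + 1))) * P N ^ e (N + 1) := by
  induction N with
  | zero => simp [h0]
  | succ N ih =>
    rw [Finset.prod_range_succ, ih, ← Finset.insert_Icc_right_eq_Icc_add_one (by omega),
      Finset.prod_insert (by simp), div_zpow, zpow_sub₀ (hP _)]
    have h1 := zpow_ne_zero (e (N + 1)) (hP N)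
    have h2 := zpow_ne_zero (e (N + 1 + 1)) (hP (N + 1))
    push_cast
    field_simp

end

lemma fNumber_natCast (m : ℕ) {r : ℤ} (hr : 0 < r) : fNumber m r = upCount (2 * m) 0 r := by
  have h1 := walkCount_sub_two_mul (2 * m) (m - r)
  have h2 := walkCount_sub_two_mul (2 * m) (m - r - 1)
  rw [upCount, if_pos hr]
  simp only [fNumber, Rat.den_natCast, Rat.num_natCast, if_true]
  push_cast at h1 h2
  rw [← h1, ← h2]
  ring_nf

lemma dNumber_natCast (m : ℕ) {r : ℤ} (hr : 0 < r) :
    dNumber m r = upCount (2 * m) 0 r - upCount (2 * m) 0 (r + 1) := by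
  rw [dNumber, fNumber_natCast m hr, fNumber_natCast m (by omega)]

lemma fNumber_natCast_eq_zero (m : ℕ) {r : ℤ} (hr : m < r) : fNumber m r = 0 := by
  simp [fNumber, intChoose, show ¬ r ≤ m by omega, show ¬ 1 ≤ m - r by omega]

lemma dNumber_of_odd {k : ℕ} (hk : Odd k) (r : ℤ) : dNumber ((k : ℚ) / 2) r = 0 := by
  have : ((k : ℚ) / 2).den ≠ 1 := by
    intro h
    have h1 := (Rat.den_eq_one_iff _).1 h
    have h2 : ((2 * ((k : ℚ) / 2).num : ℤ) : ℚ) = ((k : ℤ) : ℚ) := by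
      push_cast
      rw [h1]
      ring
    have h3 := Int.cast_injective h2
    obtain ⟨l, rfl⟩ := hk
    omega
  simp [dNumber, fNumber, this]

theorem det_gramMatrix_of_ne_zero {F : Type*} [Field F] {n : F}
    (hn : ∀ r : ℕ, (Chebyshev.S F r).eval n ≠ 0) (k : ℕ) :
    (gramMatrix k n).det =
      ∏ r ∈ Finset.Icc 1 (k / 2), (Chebyshev.S F (r : ℤ)).eval n ^ dNumber ((k : ℚ) / 2) r := by
  rcases Nat.even_or_odd k with ⟨m, rfl⟩ | hk
  · rw [← two_mul, Nat.mul_div_cancel_left m two_pos,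
      det_gramMatrix_eq_prod_weight (P := fun r => (Chebyshev.S F (r : ℤ)).eval n) hn (by simp)
        (fun a => by push_cast; simp [Chebyshev.S_add_two]),
      prod_weight_paths (P := fun r => (Chebyshev.S F (r : ℤ)).eval n) hn (N := 2 * m) (by omega)]
    have hm : ((2 * m : ℕ) : ℚ) / 2 = m := by
      push_cast
      ring
    have hzero : ∀ r : ℤ, m < r → upCount (2 * m) 0 r = 0 := fun r hr => by
      rw [← fNumber_natCast m (by omega), fNumber_natCast_eq_zero m hr]
    rw [hm, ← Finset.prod_subset (Finset.range_mono (show m ≤ 2 * m by omega))]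
    · have := prod_div_zpow (P := fun r => (Chebyshev.S F (r : ℤ)).eval n) hn (by simp)
        (upCount (2 * m) 0) m
      rw [hzero (m + 1) (by omega), zpow_zero, mul_one] at this
      simp only [Nat.cast_zero]
      rw [this]
      refine Finset.prod_congr rfl fun r hr => ?_
      rw [dNumber_natCast m (by have := (Finset.mem_Icc.1 hr).1; omega)]
    · intro r _ hr
      rw [Nat.cast_zero, hzero _ (by have := Finset.mem_range.not.1 hr; omega), zpow_zero]
  · have := isEmpty_ncPairing_of_odd hk
    rw [Matrix.det_isEmpty, Finset.prod_eq_one]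
    intro r _
    rw [dNumber_of_odd hk, zpow_zero]

lemma map_det_gramMatrix {R S : Type*} [CommRing R] [CommRing S] (f : R →+* S) (k : ℕ) (n : R) :
    f (gramMatrix k n).det = (gramMatrix k (f n)).det := by
  rw [RingHom.map_det]
  congr 1
  ext π σ
  simp [gramMatrix]

lemma chebyshev_S_ne_zero (r : ℕ) : Chebyshev.S ℤ (r : ℤ) ≠ 0 := by
  intro h
  have := Chebyshev.S_eval_two (R := ℤ) r
  rw [h] at this
  simp at this
  omega

/-- An identity with integer exponents, rewritten without negative exponents. -/
lemma eq_prod_zpow_iff {ι F : Type*} [Field F] {s : Finset ι} {x : F} {y : ι → F} {d : ι → ℤ}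
    (h : ∀ i ∈ s, d i < 0 → y i ≠ 0) :
    x = ∏ i ∈ s, y i ^ d i ↔
      x * ∏ i ∈ s, y i ^ (-d i).toNat = ∏ i ∈ s, y i ^ (d i).toNat := by
  have hne : ∏ i ∈ s, y i ^ (-d i).toNat ≠ 0 := by
    refine Finset.prod_ne_zero_iff.2 fun i hi => ?_
    by_cases hd : d i < 0
    · exact pow_ne_zero _ (h i hi hd)
    · rw [Int.toNat_of_nonpos (by omega), pow_zero]
      exact one_ne_zero
  have heq : (∏ i ∈ s, y i ^ d i) * ∏ i ∈ s, y i ^ (-d i).toNat = ∏ i ∈ s, y i ^ (d i).toNat := by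
    rw [← Finset.prod_mul_distrib]
    refine Finset.prod_congr rfl fun i hi => ?_
    by_cases hd : d i < 0
    · rw [← zpow_natCast, ← zpow_natCast, ← zpow_add₀ (h i hi hd)]
      congr 1
      omega
    · rw [Int.toNat_of_nonpos (z := -d i) (by omega), pow_zero, mul_one, ← zpow_natCast,
        Int.toNat_of_nonneg (by omega)]
  rw [← heq]
  exact (mul_left_inj' hne).symm

lemma map_chebyshev_S {R : Type*} [CommRing R] (f : ℤ[X] →+* R) (r : ℤ) :
    f (Chebyshev.S ℤ r) = (Chebyshev.S R r).eval (f X) := by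
  rw [← Chebyshev.map_S (Int.castRingHom R), eval_map]
  have : f = eval₂RingHom (Int.castRingHom R) (f X) := by
    ext <;> simp
  conv_lhs => rw [this]
  rfl

theorem det_gramMatrix_fractionRing (k : ℕ) :
    algebraMap ℤ[X] (FractionRing ℤ[X]) (gramMatrix k (X : ℤ[X])).det =
      ∏ r ∈ Finset.Icc 1 (k / 2),
        (algebraMap ℤ[X] (FractionRing ℤ[X]) (Chebyshev.S ℤ (r : ℤ))) ^
          dNumber ((k : ℚ) / 2) (r : ℤ) := by
  simp only [map_det_gramMatrix, map_chebyshev_S]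
  refine det_gramMatrix_of_ne_zero (fun r => ?_) k
  rw [← map_chebyshev_S]
  exact (map_ne_zero_iff _ (IsFractionRing.injective ℤ[X] (FractionRing ℤ[X]))).2
    (chebyshev_S_ne_zero r)

theorem det_gramMatrix_mul_prod (k : ℕ) :
    (gramMatrix k (X : ℤ[X])).det * ∏ r ∈ Finset.Icc 1 (k / 2),
        Chebyshev.S ℤ (r : ℤ) ^ (-dNumber ((k : ℚ) / 2) (r : ℤ)).toNat =
      ∏ r ∈ Finset.Icc 1 (k / 2), Chebyshev.S ℤ (r : ℤ) ^ (dNumber ((k : ℚ) / 2) (r : ℤ)).toNat := by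
  have hinj := IsFractionRing.injective ℤ[X] (FractionRing ℤ[X])
  apply hinj
  have h := (eq_prod_zpow_iff fun (r : ℕ) _ _ =>
    (map_ne_zero_iff _ hinj).2 (chebyshev_S_ne_zero r)).1 (det_gramMatrix_fractionRing k)
  simpa only [map_mul, map_prod, map_pow] using h

theorem det_gramMatrix_field {K : Type*} [Field K] (n : K) (k : ℕ)
    (hn : ∀ r ∈ Finset.Icc 1 (k / 2), dNumber ((k : ℚ) / 2) (r : ℤ) < 0 →
      (Chebyshev.S K (r : ℤ)).eval n ≠ 0) :
    (gramMatrix k n).det = ∏ r ∈ Finset.Icc 1 (k / 2),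
      ((Chebyshev.S K (r : ℤ)).eval n) ^ dNumber ((k : ℚ) / 2) (r : ℤ) := by
  rw [eq_prod_zpow_iff hn]
  have h := congrArg (eval₂RingHom (Int.castRingHom K) n) (det_gramMatrix_mul_prod k)
  simpa only [map_mul, map_prod, map_pow, map_det_gramMatrix, map_chebyshev_S, coe_eval₂RingHom,
    eval₂_X] using h

end Meander

/-- `Polynomial.Chebyshev.S R r` is the polynomial `P_r` over `R`: it satisfies `P_0 = 1`,
`P_1 = X`, `P_{r+1} = X P_r - P_{r-1}`. The exponents can be negative, so the first identity lives in
the field of fractions of `ℤ[X]`; in the second one no factor with negative exponent vanishes. -/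
theorem theorem5p1 (k : ℕ) :
    (algebraMap ℤ[X] (FractionRing ℤ[X]) (gramMatrix k (X : ℤ[X])).det =
      ∏ r ∈ Finset.Icc 1 (k / 2),
        (algebraMap ℤ[X] (FractionRing ℤ[X]) (Chebyshev.S ℤ (r : ℤ))) ^
          dNumber ((k : ℚ) / 2) (r : ℤ)) ∧
    (∀ (K : Type*) [Field K] (n : K),
      (∀ r ∈ Finset.Icc 1 (k / 2), dNumber ((k : ℚ) / 2) (r : ℤ) < 0 →
        (Chebyshev.S K (r : ℤ)).eval n ≠ 0) →
      (gramMatrix k n).det =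
        ∏ r ∈ Finset.Icc 1 (k / 2),
          ((Chebyshev.S K (r : ℤ)).eval n) ^ dNumber ((k : ℚ) / 2) (r : ℤ)) := 
  ⟨Meander.det_gramMatrix_fractionRing k,
    fun _ _ n hn => Meander.det_gramMatrix_field n k hn⟩
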